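/- Definitions. Let $\mathcal S(\mathbb R)$ be the Schwartz space and $\mathcal S'(\mathbb R)$ its continuous dual (real-valued). For $w\in\mathcal S'(\mathbb R)$ put $\|w\|_{\mathcal M}=\sup\{\langle w,\varphi\rangle:\varphi\in\mathcal S(\mathbb R),\ \|\varphi\|_\infty\le 1\}\in[0,\infty]$, and let $\mathrm D$ be the distributional derivative. Let $\mathrm{BV}^{(2)}(\mathbb R)$ be the set of $f\in\mathcal S'(\mathbb R)$ with $\mathrm{TV}^{(2)}(f)=\|\mathrm D^2 f\|_{\mathcal M}<\infty$, each identified with its continuous representative $f:\mathbb R\to\mathbb R$, with norm $\|f\|_{\mathrm{BV}^{(2)}}=\mathrm{TV}^{(2)}(f)+|f(0)|+|f(1)|$. For a layer descriptor $(N_0,\dots,N_L)$, a network $\mathbf f$ consists of matrices $\mathbf W_l\in\mathbb R^{N_l\times N_{l-1}}$ and activations $\sigma_{n,l}\in\mathrm{BV}^{(2)}(\mathbb R)$ ($1\le l\le L$, $1\le n\le N_l$). It defines the map $\mathbf f=\mathbf f_L\circ\cdots\circ\mathbf f_1:\mathbb R^{N_0}\to\mathbb R^{N_L}$, where $\mathbf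 f_l(\mathbf z)=\big(\sigma_{n,l}((\mathbf W_l\mathbf z)_n)\big)_{n=1}^{N_l}$. Theorem (existence of a deep-spline solution). Let $(\mathbf x_m,\mathbf y_m)\in\mathbb R^{N_0}\times\mathbb R^{N_L}$, $m=1,\dots,M$, be data, let $\mu_l,\lambda_l>0$, let $\mathrm E:\mathbb R^{N_L}\times\mathbb R^{N_L}\to(-\infty,+\infty]$ be proper (not identically $+\infty$) and such that, for every $\mathbf y$, the function $\mathrm E(\mathbf y,\cdot)$ is lower semicontinuous and coercive ($\mathrm E(\mathbf y,\mathbf z)\to+\infty$ as $\|\mathbf z\|\to\infty$), and let $\mathrm R_l:\mathbb R^{N_l\times N_{l-1}}\to\mathbb R$ be continuous and coercive. Consider the minimization, over all networks $\mathbf f$ with layer descriptor $(N_0,\dots,N_L)$ and activations in $\mathrm{BV}^{(2)}(\mathbb R)$, of $$\mathcal J(\mathbf f)=\sum_{m=1}^M\mathrm E\big(\mathbf y_m,\mathbf f(\mathbf x_m)\big)+\sum_{l=1}^L\mu_l\,\mathrm R_l(\mathbf W_l)+\sum_{l=1}^L\lambda_l\sum_{n=1}^{N_l}\|\sigma_{n,l}\|_{\mathrm{BV}^{(2)}}\in(-\infty,+\infty].$$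 Then there is a global minimizer $\mathbf f^*$ of $\mathcal J$ all of whose activations are linear splines $$\sigma_{n,l}(t)=\sum_{k=1}^{K_{n,l}}a_{n,l,k}\,\mathrm{ReLU}(t-\tau_{n,l,k})+b_{1,n,l}\,t+b_{2,n,l},\qquad K_{n,l}\le M,$$ with $a_{n,l,k},\tau_{n,l,k},b_{1,n,l},b_{2,n,l}\in\mathbb R$ and $\mathrm{ReLU}(t)=\max(t,0)$. -/

import Mathlib

open scoped SchwartzMap ENNReal

noncomputable section

namespace DeepSpline

/-- Real tempered distributions on the line: the continuous dual of the Schwartz space. -/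
abbrev TemperedDist : Type := 𝓢(ℝ, ℝ) →L[ℝ] ℝ

/-- The generalized derivative, `⟨D T, φ⟩ = -⟨T, φ'⟩`. -/
def distDeriv (T : TemperedDist) : TemperedDist :=
  -(T.comp (SchwartzMap.derivCLM ℝ ℝ))

/-- The total-variation norm `‖T‖_M`: the supremum of `⟨T, φ⟩` over Schwartz functions `φ` with
`‖φ‖_∞ ≤ 1`. It is `∞` exactly when `T` is not a finite signed Radon measure. (The set of
admissible `φ` is symmetric, so replacing `⟨T, φ⟩` by its positive part changes nothing.) -/
def measureNorm (T : TemperedDist) : ℝ≥0∞ :=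
  ⨆ (φ : 𝓢(ℝ, ℝ)) (_ : ∀ x, |φ x| ≤ 1), ENNReal.ofReal (T φ)

/-- The function `f` is (a pointwise representative of) the tempered distribution `T`. -/
def Represents (f : ℝ → ℝ) (T : TemperedDist) : Prop :=
  ∀ φ : 𝓢(ℝ, ℝ), MeasureTheory.Integrable (fun x => f x * φ x) ∧ T φ = ∫ x, f x * φ x

/-- The second-order total variation `TV⁽²⁾(f) = ‖D² f‖_M`. A function represents at most one
tempered distribution, so the infimum is over at most one `T`; it is `∞` if there is none. -/
def TV2 (f : ℝ → ℝ) : ℝ≥0∞ :=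
  ⨅ (T : TemperedDist) (_ : Represents f T), measureNorm (distDeriv (distDeriv T))

theorem TV2_eq_of_represents {f : ℝ → ℝ} {T : TemperedDist} (h : Represents f T) :
    TV2 f = measureNorm (distDeriv (distDeriv T)) := by
  refine le_antisymm (iInf₂_le T h) (le_iInf₂ fun S hS => ?_)
  have hST : S = T := by
    ext φ
    rw [(hS φ).2, (h φ).2]
  rw [hST]

/-- Membership in `BV⁽²⁾(ℝ)`. Every tempered distribution `f` with `‖D² f‖_M < ∞` is represented by
exactly one continuous function, through which its point values are defined; the elements of
`BV⁽²⁾(ℝ)` are taken to be these continuous functions. -/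
structure IsBV2 (f : ℝ → ℝ) : Prop where
  continuous : Continuous f
  tv2_lt_top : TV2 f < ∞

/-- The norm `‖f‖_{BV⁽²⁾} = TV⁽²⁾(f) + |f(0)| + |f(1)|`. -/
def bv2Norm (f : ℝ → ℝ) : ℝ :=
  (TV2 f).toReal + |f 0| + |f 1|

/-- A fully connected feed-forward network with layer descriptor `(N 0, …, N L)` and with
activations in `BV⁽²⁾(ℝ)`. The layer that maps `ℝ^(N l)` to `ℝ^(N (l + 1))` has index `l : Fin L`;
row `n` of `weight l` is the weight vector of its `n`th neuron. -/
structure Network {L : ℕ} (N : Fin (L + 1) → ℕ) where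
  weight : ∀ l : Fin L, Matrix (Fin (N l.succ)) (Fin (N l.castSucc)) ℝ
  activation : ∀ l : Fin L, Fin (N l.succ) → ℝ → ℝ
  activation_mem : ∀ l n, IsBV2 (activation l n)

namespace Network

variable {L : ℕ} {N : Fin (L + 1) → ℕ}

/-- One layer, `z ↦ (σ_n (w_nᵀ z))_n`. -/
def layer (f : Network N) (l : Fin L) (z : Fin (N l.castSucc) → ℝ) : Fin (N l.succ) → ℝ :=
  fun n => f.activation l n ((f.weight l).mulVec z n)

/-- The output of the first `i` layers. -/
def partialEval (f : Network N) (x : Fin (N 0) → ℝ) (i : Fin (L + 1)) : Fin (N i) → ℝ :=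
  Fin.induction (motive := fun i => Fin (N i) → ℝ) x (fun l z => f.layer l z) i

/-- The input-output map, the composition of all the layers. -/
def eval (f : Network N) (x : Fin (N 0) → ℝ) : Fin (N (Fin.last L)) → ℝ :=
  f.partialEval x (Fin.last L)

/-- `‖σ_l‖_{BV⁽²⁾,1}`. -/
def layerNorm (f : Network N) (l : Fin L) : ℝ :=
  ∑ n, bv2Norm (f.activation l n)

end Network

/-- The training cost
`∑ₘ E(yₘ, f(xₘ)) + ∑ₗ μₗ Rₗ(Wₗ) + ∑ₗ λₗ ‖σₗ‖_{BV⁽²⁾,1}`, with values in the extended reals. -/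
def cost {L : ℕ} {N : Fin (L + 1) → ℕ} {M : ℕ}
    (x : Fin M → Fin (N 0) → ℝ) (y : Fin M → Fin (N (Fin.last L)) → ℝ)
    (E : (Fin (N (Fin.last L)) → ℝ) → (Fin (N (Fin.last L)) → ℝ) → EReal)
    (R : ∀ l : Fin L, Matrix (Fin (N l.succ)) (Fin (N l.castSucc)) ℝ → ℝ)
    (μ lam : Fin L → ℝ) (f : Network N) : EReal :=
  (∑ m, E (y m) (f.eval (x m)))
    + ((∑ l, μ l * R l (f.weight l) + ∑ l, lam l * f.layerNorm l : ℝ) : EReal)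

/-- An extended-real function is proper: it is nowhere `-∞` and somewhere finite. -/
def IsProper {X : Type*} (F : X → EReal) : Prop :=
  (∀ p, F p ≠ ⊥) ∧ ∃ p, F p ≠ ⊤

/-- Coercivity on a finite-dimensional space (whose complements of bounded sets generate
`cocompact`): `F(z) → +∞` as `‖z‖ → ∞`. -/
def IsCoercive {X : Type*} [TopologicalSpace X] (F : X → EReal) : Prop :=
  Filter.Tendsto F (Filter.cocompact X) (nhds ⊤)

/-- A linear spline `∑ₖ aₖ ReLU(t - τₖ) + b₁ t + b₂` with at most `M` knots. -/
def IsLinearSpline (M : ℕ) (f : ℝ → ℝ) : Prop :=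
  ∃ K : ℕ, K ≤ M ∧ ∃ (a τ : Fin K → ℝ) (b₁ b₂ : ℝ),
    ∀ t, f t = ∑ k, a k * max (t - τ k) 0 + b₁ * t + b₂

end DeepSpline

end

namespace DeepSpline

open MeasureTheory Filter Topology Convolution

/-! The data term sees an activation only at the `M` inputs that its neuron receives from the data,
and the point values in the norm are those at 0 and 1. Interpolate each activation at these at most
`M + 2` points by a linear spline with knots at all of them except the two extremes. The outputs on
the data do not change, there are at most `M` knots, and the norm does not grow
(`exists_spline_interpolation`, `IsBV2.exists_spline`).

The norm bound is duality. If `Φ(t) = ∑ c_p (t - p)₊` has compact support and `|Φ| ≤ 1`, then `∑ c_p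
f(p) = ⟨D² f, Φ⟩ ≤ TV⁽²⁾(f)`, made rigorous by mollification (`ofReal_sum_le_TV2`). Choosing `Φ`
piecewise linear with value `sign a_k` at each knot of the interpolant and 0 at the extremes turns
the pairing into `∑ |a_k|`.

What remains is finite-dimensional. A bound on the cost confines the weights by coercivity and
bounds the activation norms; linear growth (`IsBV2.abs_le`) carries bounds through the layers, so
the knots stay bounded too. On the resulting compact set the lower semicontinuous `splineCost`,
which charges `∑ |a_k|` for the total variation, attains its minimum. It dominates the cost of the
spline network, and every network below the cost level dominates one of its values on the compact
set, so the minimizer is global. -/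

/-! ### Ramps and affine functions as tempered distributions -/

theorem hasTemperateGrowth_restrict (s : Set ℝ) :
    ((volume : Measure ℝ).restrict s).HasTemperateGrowth := by
  obtain ⟨n, hn⟩ := (inferInstance : (volume : Measure ℝ).HasTemperateGrowth).exists_integrable
  exact ⟨⟨n, hn.restrict⟩⟩

theorem hasTemperateGrowth_affine (a b : ℝ) :
    Function.HasTemperateGrowth (fun t : ℝ => a * t + b) := by
  fun_prop

theorem integrable_ramp_mul (p : ℝ) (φ : 𝓢(ℝ, ℝ)) :
    Integrable (fun t => max (t - p) 0 * φ t) := by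
  have h := (SchwartzMap.smulLeftCLM ℝ (fun t : ℝ => 1 * t + -p) φ).integrable (μ := volume)
  refine h.mono (Continuous.aestronglyMeasurable (by fun_prop)) (Eventually.of_forall fun t => ?_)
  rw [SchwartzMap.smulLeftCLM_apply_apply (hasTemperateGrowth_affine _ _), norm_mul, norm_smul]
  gcongr
  rw [Real.norm_eq_abs, Real.norm_eq_abs, abs_of_nonneg (le_max_right _ _)]
  exact max_le (by rw [one_mul]; exact le_abs_self _) (abs_nonneg _)

theorem integrable_affine_mul (a b : ℝ) (φ : 𝓢(ℝ, ℝ)) :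
    Integrable (fun t => (a * t + b) * φ t) := by
  have h := (SchwartzMap.smulLeftCLM ℝ (fun t : ℝ => a * t + b) φ).integrable (μ := volume)
  rwa [SchwartzMap.smulLeftCLM_apply (hasTemperateGrowth_affine _ _)] at h

/-- The ramp is not smooth, so it is not a multiplier of Schwartz functions; on the half-line it
agrees with an affine function, which is. -/
theorem integral_ramp_mul_eq_setIntegral (p : ℝ) (φ : ℝ → ℝ) :
    ∫ t, max (t - p) 0 * φ t = ∫ t in Set.Ioi p, (1 * t + -p) * φ t := by
  rw [← integral_indicator measurableSet_Ioi]
  congr 1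
  ext t
  by_cases h : p < t
  · rw [Set.indicator_of_mem (by exact h), max_eq_left (by linarith)]; ring
  · rw [Set.indicator_of_notMem (by exact h), max_eq_right (by linarith), zero_mul]

/-- An antiderivative of `(a t + b) φ''(t)` is `(a t + b) φ'(t) - a φ(t)`. -/
theorem hasDerivAt_affine_mul_deriv_sub (a b : ℝ) (φ : 𝓢(ℝ, ℝ)) (t : ℝ) :
    HasDerivAt (⇑(SchwartzMap.smulLeftCLM ℝ (fun t : ℝ => a * t + b)
        (SchwartzMap.derivCLM ℝ ℝ φ) - a • φ))
      ((a * t + b) * SchwartzMap.derivCLM ℝ ℝ (SchwartzMap.derivCLM ℝ ℝ φ) t) t := by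
  have e : ⇑(SchwartzMap.smulLeftCLM ℝ (fun t : ℝ => a * t + b)
      (SchwartzMap.derivCLM ℝ ℝ φ) - a • φ)
      = fun t => (a * t + b) * SchwartzMap.derivCLM ℝ ℝ φ t - a * φ t := by
    ext t
    simp [SchwartzMap.smulLeftCLM_apply_apply (hasTemperateGrowth_affine a b)]
  rw [e]
  have h1 : HasDerivAt (fun t : ℝ => a * t + b) a t := by
    simpa using ((hasDerivAt_id t).const_mul a).add_const b
  have h2 := (SchwartzMap.derivCLM ℝ ℝ φ).differentiableAt (x := t) |>.hasDerivAt
  have h3 := φ.differentiableAt (x := t) |>.hasDerivAt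
  refine ((h1.mul h2).sub (h3.const_mul a)).congr_deriv (Eq.symm ?_)
  change _ = a * deriv φ t + (a * t + b) * _ - a * deriv φ t
  rw [add_sub_cancel_left]
  rfl

/-- The ramp is a Green's function of `D²`: the antiderivative vanishes at infinity, and at `p` only
its term `-φ(p)` survives. -/
theorem integral_ramp_mul_deriv_deriv (p : ℝ) (φ : 𝓢(ℝ, ℝ)) :
    ∫ t, max (t - p) 0 * SchwartzMap.derivCLM ℝ ℝ (SchwartzMap.derivCLM ℝ ℝ φ) t = φ p := by
  rw [integral_ramp_mul_eq_setIntegral,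
    integral_Ioi_of_hasDerivAt_of_tendsto'
      (fun t _ => hasDerivAt_affine_mul_deriv_sub 1 (-p) φ t)
      (integrable_affine_mul _ _ _).integrableOn
      ((SchwartzMap.tendsto_cocompact _).mono_left atTop_le_cocompact)]
  rw [sub_apply, SchwartzMap.smulLeftCLM_apply_apply (hasTemperateGrowth_affine 1 (-p))]
  simp

theorem integral_affine_mul_deriv_deriv (a b : ℝ) (φ : 𝓢(ℝ, ℝ)) :
    ∫ t, (a * t + b) * SchwartzMap.derivCLM ℝ ℝ (SchwartzMap.derivCLM ℝ ℝ φ) t = 0 := by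
  rw [integral_of_hasDerivAt_of_tendsto (hasDerivAt_affine_mul_deriv_sub a b φ)
      (integrable_affine_mul _ _ _)
      ((SchwartzMap.tendsto_cocompact _).mono_left atBot_le_cocompact)
      ((SchwartzMap.tendsto_cocompact _).mono_left atTop_le_cocompact), sub_self]

/-- The tempered distribution of the ramp `t ↦ max (t - p) 0`. -/
noncomputable def rampDist (p : ℝ) : TemperedDist :=
  haveI := hasTemperateGrowth_restrict (Set.Ioi p)
  (SchwartzMap.integralCLM ℝ (volume.restrict (Set.Ioi p))).comp
    (SchwartzMap.smulLeftCLM ℝ (fun t : ℝ => 1 * t + -p))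

/-- The tempered distribution of an affine function. -/
noncomputable def affineDist (a b : ℝ) : TemperedDist :=
  (SchwartzMap.integralCLM ℝ volume).comp (SchwartzMap.smulLeftCLM ℝ (fun t : ℝ => a * t + b))

theorem represents_rampDist (p : ℝ) : Represents (fun t => max (t - p) 0) (rampDist p) := by
  refine fun φ => ⟨integrable_ramp_mul p φ, ?_⟩
  rw [integral_ramp_mul_eq_setIntegral]
  rw [rampDist, ContinuousLinearMap.comp_apply, SchwartzMap.integralCLM_apply,
    SchwartzMap.smulLeftCLM_apply (hasTemperateGrowth_affine 1 (-p))]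
  rfl

theorem represents_affineDist (a b : ℝ) : Represents (fun t => a * t + b) (affineDist a b) := by
  refine fun φ => ⟨integrable_affine_mul a b φ, ?_⟩
  simp [affineDist, SchwartzMap.smulLeftCLM_apply_apply (hasTemperateGrowth_affine a b)]

theorem Represents.add {f g : ℝ → ℝ} {S T : TemperedDist} (hf : Represents f S)
    (hg : Represents g T) : Represents (fun t => f t + g t) (S + T) := by
  refine fun φ => ⟨?_, ?_⟩
  · simp only [add_mul]; exact (hf φ).1.add (hg φ).1
  · simp only [add_mul]
    rw [integral_add (hf φ).1 (hg φ).1, ← (hf φ).2, ← (hg φ).2]; rfl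

theorem Represents.const_mul {f : ℝ → ℝ} {T : TemperedDist} (hf : Represents f T) (c : ℝ) :
    Represents (fun t => c * f t) (c • T) := by
  refine fun φ => ⟨?_, ?_⟩
  · simp only [mul_assoc]; exact (hf φ).1.const_mul c
  · simp only [mul_assoc]
    rw [integral_const_mul, ← (hf φ).2]; rfl

theorem represents_zero : Represents (fun _ => 0) 0 := fun φ => by simp

theorem Represents.sum {ι : Type*} (s : Finset ι) {f : ι → ℝ → ℝ} {T : ι → TemperedDist}
    (h : ∀ i ∈ s, Represents (f i) (T i)) :
    Represents (fun t => ∑ i ∈ s, f i t) (∑ i ∈ s, T i) := by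
  classical
  induction s using Finset.induction_on with
  | empty => simpa using represents_zero
  | insert i s hi ih =>
    simp only [Finset.sum_insert hi]
    exact (h i (Finset.mem_insert_self _ _)).add
      (ih fun j hj => h j (Finset.mem_insert_of_mem hj))

theorem distDeriv_distDeriv_apply (T : TemperedDist) (φ : 𝓢(ℝ, ℝ)) :
    distDeriv (distDeriv T) φ = T (SchwartzMap.derivCLM ℝ ℝ (SchwartzMap.derivCLM ℝ ℝ φ)) := by
  simp [distDeriv]

/-- The second-order total variation of a spline is at most the sum of its slope changes. -/
theorem TV2_spline_le {ι : Type*} (s : Finset ι) (a τ : ι → ℝ) (b₁ b₂ : ℝ) :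
    TV2 (fun t => ∑ k ∈ s, a k * max (t - τ k) 0 + (b₁ * t + b₂))
      ≤ ENNReal.ofReal (∑ k ∈ s, |a k|) := by
  have h := (Represents.sum s fun k _ => (represents_rampDist (τ k)).const_mul (a k)).add
    (represents_affineDist b₁ b₂)
  rw [TV2_eq_of_represents h]
  refine iSup₂_le fun φ hφ => ENNReal.ofReal_le_ofReal ?_
  have hr : ∀ p, rampDist p (SchwartzMap.derivCLM ℝ ℝ (SchwartzMap.derivCLM ℝ ℝ φ)) = φ p :=
    fun p => by rw [(represents_rampDist p _).2, integral_ramp_mul_deriv_deriv]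
  have ha : affineDist b₁ b₂ (SchwartzMap.derivCLM ℝ ℝ (SchwartzMap.derivCLM ℝ ℝ φ)) = 0 := by
    rw [(represents_affineDist b₁ b₂ _).2, integral_affine_mul_deriv_deriv]
  rw [distDeriv_distDeriv_apply, add_apply, ha, add_zero,
    sum_apply]
  refine Finset.sum_le_sum fun k _ => ?_
  rw [smul_apply, hr, smul_eq_mul]
  refine (le_abs_self _).trans ?_
  rw [abs_mul]
  exact mul_le_of_le_one_right (abs_nonneg _) (hφ _)

/-! ### Duality: lower bounds for the second-order total variation -/

theorem deriv_deriv_comp_const_sub (η : ℝ → ℝ) (x t : ℝ) :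
    deriv (deriv fun t => η (x - t)) t = deriv (deriv η) (x - t) := by
  have : deriv (fun t => η (x - t)) = fun t => -deriv η (x - t) := by
    ext t; exact deriv_comp_const_sub ..
  rw [this]
  simp [deriv_comp_const_sub, deriv.fun_neg]

/-- A mollified compactly supported spline is an admissible test function. -/
theorem mollified_pairing_le {f : ℝ → ℝ} (hf : Continuous f) {T : TemperedDist}
    (hT : Represents f T) (s : Finset ℝ) (c : ℝ → ℝ)
    (hc : HasCompactSupport fun t => ∑ p ∈ s, c p * max (t - p) 0)
    (hb : ∀ t, |∑ p ∈ s, c p * max (t - p) 0| ≤ 1) (b : ContDiffBump (0 : ℝ)) :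
    ENNReal.ofReal (∑ p ∈ s, c p * (b.normed volume ⋆[ContinuousLinearMap.lsmul ℝ ℝ, volume] f) p)
      ≤ measureNorm (distDeriv (distDeriv T)) := by
  set η : ℝ → ℝ := b.normed volume with hη
  set Φ : ℝ → ℝ := fun t => ∑ p ∈ s, c p * max (t - p) 0 with hΦ
  have hΦc : Continuous Φ := by fun_prop
  have hΦl : LocallyIntegrable Φ := hΦc.locallyIntegrable
  have hηs : HasCompactSupport η := b.hasCompactSupport_normed
  have hηd : ContDiff ℝ (⊤ : ℕ∞) η := b.contDiff_normed
  have hηd' : ContDiff ℝ (⊤ : ℕ∞) (deriv η) := ((contDiff_infty_iff_deriv).1 hηd).2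
  set L := ContinuousLinearMap.lsmul ℝ ℝ (E := ℝ)
  have hψd : ContDiff ℝ (⊤ : ℕ∞) (Φ ⋆[L, volume] η) := hηs.contDiff_convolution_right L hΦl hηd
  have hψs : HasCompactSupport (Φ ⋆[L, volume] η) := hc.convolution L hηs
  set φ : 𝓢(ℝ, ℝ) := hψs.toSchwartzMap hψd
  have hφv : ∀ x, φ x = ∫ t, Φ t * η (x - t) := fun x => rfl
  have hle : ∀ x, |φ x| ≤ 1 := by
    intro x
    have hint : Integrable (fun t => η (x - t)) := b.integrable_normed.comp_sub_left x
    have h1 : ∫ t, η (x - t) = 1 := by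
      rw [integral_sub_left_eq_self η volume x]; exact b.integral_normed
    rw [hφv, ← h1, ← Real.norm_eq_abs]
    refine norm_integral_le_of_norm_le hint (Eventually.of_forall fun t => ?_)
    rw [norm_mul, Real.norm_of_nonneg (b.nonneg_normed (x - t))]
    exact mul_le_of_le_one_left (b.nonneg_normed _) (hb t)
  -- As `Φ'' = ∑ c_p δ_p`, the mollified `Φ` has second derivative `∑ c_p η(x - p)`; the bump is
  -- even.
  have hd2 : ∀ x, SchwartzMap.derivCLM ℝ ℝ (SchwartzMap.derivCLM ℝ ℝ φ) x
      = ∑ p ∈ s, c p * η (p - x) := by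
    intro x
    have e1 : deriv (Φ ⋆[L, volume] η) = Φ ⋆[L, volume] deriv η := by
      ext x
      exact (hηs.hasDerivAt_convolution_right L hΦl (hηd.of_le (by exact_mod_cast le_top)) x).deriv
    have e2 : deriv (Φ ⋆[L, volume] deriv η) x = (Φ ⋆[L, volume] deriv (deriv η)) x :=
      (hηs.deriv.hasDerivAt_convolution_right L hΦl
        (hηd'.of_le (by exact_mod_cast le_top)) x).deriv
    have e3 : SchwartzMap.derivCLM ℝ ℝ (SchwartzMap.derivCLM ℝ ℝ φ) x
        = (Φ ⋆[L, volume] deriv (deriv η)) x := by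
      rw [← e2, ← e1, SchwartzMap.derivCLM_apply]
      rfl
    -- Read as a function of `t`, the kernel `η (x - t)` is itself a test function, so the Green
    -- identity applies to each ramp.
    have hχs : HasCompactSupport fun t => η (x - t) := hηs.comp_homeomorph (Homeomorph.subLeft x)
    have hχd : ContDiff ℝ (⊤ : ℕ∞) fun t => η (x - t) := hηd.comp (by fun_prop)
    set χ : 𝓢(ℝ, ℝ) := hχs.toSchwartzMap hχd
    have e4 : ∀ t, SchwartzMap.derivCLM ℝ ℝ (SchwartzMap.derivCLM ℝ ℝ χ) t
        = deriv (deriv η) (x - t) := fun t => deriv_deriv_comp_const_sub η x t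
    rw [e3, convolution_lsmul]
    have e5 : ∀ t, Φ t • deriv (deriv η) (x - t) = ∑ p ∈ s, c p * (max (t - p) 0 *
        SchwartzMap.derivCLM ℝ ℝ (SchwartzMap.derivCLM ℝ ℝ χ) t) := by
      intro t
      rw [e4, smul_eq_mul, hΦ]
      simp only [Finset.sum_mul, mul_assoc]
    simp only [e5]
    rw [integral_finsetSum _ fun p _ => (integrable_ramp_mul p _).const_mul (c p)]
    refine Finset.sum_congr rfl fun p _ => ?_
    rw [integral_const_mul, integral_ramp_mul_deriv_deriv]
    congr 1
    change η (x - p) = η (p - x)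
    rw [hη, ← b.normed_neg, neg_sub]
  -- The mollifier moves from `Φ` to `f`.
  have hval : T (SchwartzMap.derivCLM ℝ ℝ (SchwartzMap.derivCLM ℝ ℝ φ))
      = ∑ p ∈ s, c p * (η ⋆[L, volume] f) p := by
    rw [(hT _).2]
    have hi : ∀ p, Integrable fun x => η (p - x) * f x := fun p =>
      ((hηd.continuous.comp (by fun_prop)).mul hf).integrable_of_hasCompactSupport
        (HasCompactSupport.mul_right (hηs.comp_homeomorph (Homeomorph.subLeft p)))
    have e6 : ∀ x, f x * SchwartzMap.derivCLM ℝ ℝ (SchwartzMap.derivCLM ℝ ℝ φ) x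
        = ∑ p ∈ s, c p * (η (p - x) * f x) := by
      intro x
      rw [hd2, Finset.mul_sum]
      exact Finset.sum_congr rfl fun p _ => by ring
    simp only [e6]
    rw [integral_finsetSum _ fun p _ => (hi p).const_mul (c p)]
    refine Finset.sum_congr rfl fun p _ => ?_
    rw [integral_const_mul, convolution_lsmul_swap]
    rfl
  rw [← hval, ← distDeriv_distDeriv_apply]
  exact le_iSup₂ (f := fun (φ : 𝓢(ℝ, ℝ)) (_ : ∀ x, |φ x| ≤ 1) =>
    ENNReal.ofReal (distDeriv (distDeriv T) φ)) φ hle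

/-- Second-order total variation is bounded below by pairing with compactly supported splines. -/
theorem ofReal_sum_le_TV2 {f : ℝ → ℝ} (hf : Continuous f) (s : Finset ℝ) (c : ℝ → ℝ)
    (hc : HasCompactSupport fun t => ∑ p ∈ s, c p * max (t - p) 0)
    (hb : ∀ t, |∑ p ∈ s, c p * max (t - p) 0| ≤ 1) :
    ENNReal.ofReal (∑ p ∈ s, c p * f p) ≤ TV2 f := by
  refine le_iInf₂ fun T hT => ?_
  let b : ℕ → ContDiffBump (0 : ℝ) := fun n =>
    ⟨1 / (n + 1) / 2, 1 / (n + 1), by positivity, half_lt_self (by positivity)⟩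
  have hb0 : Tendsto (fun n => (b n).rOut) atTop (𝓝 0) := tendsto_one_div_add_atTop_nhds_zero_nat
  have hlim : Tendsto (fun n => ∑ p ∈ s, c p *
      ((b n).normed volume ⋆[ContinuousLinearMap.lsmul ℝ ℝ, volume] f) p) atTop
      (𝓝 (∑ p ∈ s, c p * f p)) :=
    tendsto_finsetSum _ fun p _ =>
      (ContDiffBump.convolution_tendsto_right_of_continuous hb0 hf p).const_mul (c p)
  exact le_of_tendsto (ENNReal.tendsto_ofReal hlim)
    (Eventually.of_forall fun n => mollified_pairing_le hf hT s c hc hb (b n))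

/-! ### Interpolation by ramps -/

theorem sum_ramp_of_forall_le (Q : Finset ℝ) (c : ℝ → ℝ) {t : ℝ} (ht : ∀ k ∈ Q, k ≤ t) :
    ∑ k ∈ Q, c k * max (t - k) 0 = (∑ k ∈ Q, c k) * t - ∑ k ∈ Q, c k * k := by
  rw [Finset.sum_mul, ← Finset.sum_sub_distrib]
  refine Finset.sum_congr rfl fun k hk => ?_
  rw [max_eq_left (by linarith [ht k hk])]; ring

/-- Interpolation by ramps with knots at the interpolation points; to the left of the last point the
interpolant obeys the same bound as the data. -/
theorem exists_ramp_interpolation (p₀ : ℝ) (v : ℝ → ℝ) (hv : v p₀ = 0) (M : ℝ) (S : Finset ℝ)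
    (hS : ∀ k ∈ S, p₀ < k) (hM : ∀ k ∈ insert p₀ S, |v k| ≤ M) :
    ∃ c : ℝ → ℝ,
      (∀ q ∈ insert p₀ S, ∑ k ∈ insert p₀ S, c k * max (q - k) 0 = v q) ∧
      ∀ q ∈ insert p₀ S, ∀ t ≤ q, |∑ k ∈ insert p₀ S, c k * max (t - k) 0| ≤ M := by
  induction S using Finset.induction_on_max with
  | empty =>
    have h0 : 0 ≤ M := (abs_nonneg _).trans (hM p₀ (by simp))
    exact ⟨0, by simp [hv], by simp [h0]⟩
  | insert q S hq ih =>
    obtain ⟨c, hc, hcM⟩ := ih (fun k hk => hS k (Finset.mem_insert_of_mem hk)) (fun k hk => hM k (by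
      rw [Finset.insert_comm]; exact Finset.mem_insert_of_mem hk))
    set Q := insert p₀ S with hQ
    have hQq : ∀ k ∈ Q, k < q := by
      intro k hk
      rcases Finset.mem_insert.1 hk with rfl | hk
      · exact hS q (Finset.mem_insert_self _ _)
      · exact hq k hk
    have hqQ : q ∉ Q := fun h => lt_irrefl _ (hQq q h)
    have hne : Q.Nonempty := ⟨p₀, Finset.mem_insert_self _ _⟩
    set p := Q.max' hne with hp
    have hpQ : p ∈ Q := Q.max'_mem hne
    have hpq : 0 < q - p := sub_pos.2 (hQq p hpQ)
    have hle : ∀ k ∈ Q, k ≤ p := fun k hk => Q.le_max' k hk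
    set Φ : ℝ → ℝ := fun t => ∑ k ∈ Q, c k * max (t - k) 0 with hΦ
    -- The change of slope at the last old knot `p` that corrects the value at `q`; nothing changes
    -- left of `p`. The knot `q` gets coefficient 0 until a later point requires a bend there.
    set d := (v q - Φ q) / (q - p) with hd
    refine ⟨fun k => if k = q then 0 else c k + if k = p then d else 0, ?_⟩
    have hsum : ∀ t, (∑ k ∈ insert p₀ (insert q S),
        (if k = q then 0 else c k + if k = p then d else 0) * max (t - k) 0)
        = Φ t + d * max (t - p) 0 := by
      intro t
      rw [Finset.insert_comm, ← hQ, Finset.sum_insert hqQ, if_pos rfl, zero_mul, zero_add]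
      have : ∀ k ∈ Q, (if k = q then 0 else c k + if k = p then d else 0) * max (t - k) 0
          = c k * max (t - k) 0 + if k = p then d * max (t - p) 0 else 0 := by
        intro k hk
        rw [if_neg (hQq k hk).ne, add_mul]
        split_ifs with h
        · rw [h]
        · rw [zero_mul]
      rw [Finset.sum_congr rfl this, Finset.sum_add_distrib, Finset.sum_ite_eq' Q p, if_pos hpQ]
    simp only [hsum]
    have hold : ∀ t ≤ p, Φ t + d * max (t - p) 0 = Φ t := by
      intro t ht
      rw [max_eq_right (by linarith), mul_zero, add_zero]
    have hnew : Φ q + d * max (q - p) 0 = v q := by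
      rw [max_eq_left hpq.le, hd, div_mul_cancel₀ _ hpq.ne']; ring
    have haff : ∀ t, p ≤ t → Φ t = (∑ k ∈ Q, c k) * t - ∑ k ∈ Q, c k * k := fun t ht =>
      sum_ramp_of_forall_le Q c fun k hk => (hle k hk).trans ht
    refine ⟨fun r hr => ?_, fun r hr t ht => ?_⟩
    · rw [Finset.insert_comm, ← hQ] at hr
      rcases Finset.mem_insert.1 hr with rfl | hr
      · exact hnew
      · rw [hold r (hle r hr), hΦ]; exact hc r hr
    · rcases le_or_gt t p with htp | htp
      · rw [hold t htp]; exact hcM p hpQ t htp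
      · have htq : t ≤ q := by
          rw [Finset.insert_comm, ← hQ] at hr
          rcases Finset.mem_insert.1 hr with rfl | hr
          · exact ht
          · exact ht.trans (hQq r hr).le
        have hvp : Φ p = v p := hc p hpQ
        have hMp := hM p (by rw [Finset.insert_comm]; exact Finset.mem_insert_of_mem hpQ)
        have hMq := hM q (by simp)
        -- Between `p` and `q` the interpolant is affine, hence a convex combination of two data
        -- values.
        have key : Φ t + d * max (t - p) 0
            = (q - t) / (q - p) * v p + (t - p) / (q - p) * v q := by
          rw [max_eq_left hpq.le] at hnew
          rw [max_eq_left (by linarith), ← hvp, ← hnew, haff t htp.le, haff p le_rfl,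
            haff q (by linarith)]
          field_simp
          ring
        have h1 : 0 ≤ (q - t) / (q - p) := div_nonneg (by linarith) hpq.le
        have h2 : 0 ≤ (t - p) / (q - p) := div_nonneg (by linarith) hpq.le
        have h3 : (q - t) / (q - p) + (t - p) / (q - p) = 1 := by field_simp; ring
        rw [key]
        calc _ ≤ (q - t) / (q - p) * |v p| + (t - p) / (q - p) * |v q| := by
              refine (abs_add_le _ _).trans ?_
              rw [abs_mul, abs_mul, abs_of_nonneg h1, abs_of_nonneg h2]
          _ ≤ (q - t) / (q - p) * M + (t - p) / (q - p) * M := by gcongr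
          _ = M := by rw [← add_mul, h3, one_mul]

/-- Bounded data that vanish at the two extreme points are interpolated by a compactly supported
spline with the same bound. -/
theorem exists_compactlySupported_interpolation {p₀ p₁ : ℝ} (h01 : p₀ < p₁) (I : Finset ℝ)
    (hI : ∀ k ∈ I, p₀ < k ∧ k < p₁) (v : ℝ → ℝ) (hv₀ : v p₀ = 0) (hv₁ : v p₁ = 0)
    (hv : ∀ k, |v k| ≤ 1) :
    ∃ c : ℝ → ℝ,
      (∀ q ∈ I, ∑ k ∈ insert p₀ (insert p₁ I), c k * max (q - k) 0 = v q) ∧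
      (∀ t, |∑ k ∈ insert p₀ (insert p₁ I), c k * max (t - k) 0| ≤ 1) ∧
      HasCompactSupport (fun t => ∑ k ∈ insert p₀ (insert p₁ I), c k * max (t - k) 0) ∧
      ∑ k ∈ insert p₀ (insert p₁ I), c k = 0 ∧
      ∑ k ∈ insert p₀ (insert p₁ I), c k * k = 0 := by
  obtain ⟨c, hc, hcM⟩ := exists_ramp_interpolation p₀ v hv₀ 1 (insert p₁ I) (by
    intro k hk
    rcases Finset.mem_insert.1 hk with rfl | hk
    · exact h01
    · exact (hI k hk).1) (fun k _ => hv k)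
  set P := insert p₀ (insert p₁ I) with hP
  have hp1 : p₁ ∈ P := by simp [hP]
  have hge : ∀ k ∈ P, p₀ ≤ k := by
    intro k hk
    simp only [hP, Finset.mem_insert] at hk
    rcases hk with rfl | rfl | hk
    exacts [le_rfl, h01.le, (hI k hk).1.le]
  have hle : ∀ k ∈ P, k ≤ p₁ := by
    intro k hk
    simp only [hP, Finset.mem_insert] at hk
    rcases hk with rfl | rfl | hk
    exacts [h01.le, le_rfl, (hI k hk).2.le]
  -- The slope to the right of `p₁`. Removing it at the knot `p₁` makes the function constant there,
  -- equal to its value 0 at `p₁`.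
  set d := ∑ k ∈ P, c k with hd
  have hsum : ∀ F : ℝ → ℝ, ∑ k ∈ P, (c k - if k = p₁ then d else 0) * F k
      = ∑ k ∈ P, c k * F k - d * F p₁ := by
    intro F
    have : ∀ k ∈ P, (c k - if k = p₁ then d else 0) * F k
        = c k * F k - if k = p₁ then d * F p₁ else 0 := by
      intro k _
      split_ifs with h
      · rw [h]; ring
      · ring
    rw [Finset.sum_congr rfl this, Finset.sum_sub_distrib, Finset.sum_ite_eq' P p₁, if_pos hp1]
  have hleft : ∀ t ≤ p₁, ∑ k ∈ P, (c k - if k = p₁ then d else 0) * max (t - k) 0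
      = ∑ k ∈ P, c k * max (t - k) 0 := by
    intro t ht
    rw [hsum fun k => max (t - k) 0, max_eq_right (by linarith), mul_zero, sub_zero]
  have hz : ∑ k ∈ P, (c k - if k = p₁ then d else 0) = 0 := by
    have := hsum fun _ => 1
    simpa [← hd] using this
  have hright : ∀ t, p₁ ≤ t →
      ∑ k ∈ P, (c k - if k = p₁ then d else 0) * max (t - k) 0 = 0 := by
    intro t ht
    have h1 := hleft p₁ le_rfl
    rw [hc p₁ hp1, hv₁, sum_ramp_of_forall_le P _ hle, hz] at h1
    rw [sum_ramp_of_forall_le P _ fun k hk => (hle k hk).trans ht, hz]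
    linarith
  refine ⟨fun k => c k - if k = p₁ then d else 0, fun q hq => ?_, fun t => ?_, ?_, hz, ?_⟩
  · rw [hleft q (hI q hq).2.le, hc q (by simp [hP, hq])]
  · rcases le_or_gt t p₁ with ht | ht
    · rw [hleft t ht]; exact hcM p₁ hp1 t ht
    · rw [hright t ht.le]; simp
  · refine HasCompactSupport.intro (isCompact_Icc (a := p₀) (b := p₁)) fun t ht => ?_
    rcases le_or_gt p₁ t with h | h
    · exact hright t h
    · have h0 : t < p₀ := by
        by_contra h'
        exact ht ⟨not_lt.1 h', h.le⟩
      refine Finset.sum_eq_zero fun k hk => ?_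
      rw [max_eq_right (by linarith [hge k hk]), mul_zero]
  · have h := hright p₁ le_rfl
    rw [sum_ramp_of_forall_le P _ hle, hz] at h
    linarith

/-! ### Spline interpolation does not increase the total variation -/

/-- The spline that interpolates `f` at `p₀ < ⋯ < p₁` with knots at the interior points has at most
the second-order total variation of `f`. -/
theorem exists_spline_interpolation_of_lt {f : ℝ → ℝ} (hf : Continuous f) {p₀ p₁ : ℝ}
    (h01 : p₀ < p₁) (I : Finset ℝ) (hI : ∀ k ∈ I, p₀ < k ∧ k < p₁) :
    ∃ (a : ℝ → ℝ) (b₁ b₂ : ℝ),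
      (∀ t ∈ insert p₀ (insert p₁ I), f t = ∑ k ∈ I, a k * max (t - k) 0 + (b₁ * t + b₂)) ∧
      ENNReal.ofReal (∑ k ∈ I, |a k|) ≤ TV2 f := by
  have hn0 : p₀ ∉ insert p₁ I := by
    intro h
    rcases Finset.mem_insert.1 h with h | h
    · exact h01.ne h
    · exact lt_irrefl _ (hI _ h).1
  have hn1 : p₁ ∉ I := fun h => lt_irrefl _ (hI _ h).2
  have hge : ∀ k ∈ insert p₀ (insert p₁ I), p₀ ≤ k := by
    intro k hk
    simp only [Finset.mem_insert] at hk
    rcases hk with rfl | rfl | hk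
    exacts [le_rfl, h01.le, (hI k hk).1.le]
  have hle : ∀ k ∈ insert p₀ (insert p₁ I), k ≤ p₁ := by
    intro k hk
    simp only [Finset.mem_insert] at hk
    rcases hk with rfl | rfl | hk
    exacts [h01.le, le_rfl, (hI k hk).2.le]
  obtain ⟨M, hM⟩ : ∃ M, ∀ k ∈ insert p₀ (insert p₁ I), |f k - f p₀| ≤ M := by
    obtain ⟨M, hM⟩ := ((insert p₀ (insert p₁ I)).image fun k => |f k - f p₀|).bddAbove
    exact ⟨M, fun k hk => hM (by
      exact Finset.mem_coe.2 (Finset.mem_image_of_mem (fun k => |f k - f p₀|) hk))⟩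
  obtain ⟨a, ha, -⟩ := exists_ramp_interpolation p₀ (fun t => f t - f p₀) (sub_self _) M
    (insert p₁ I) (by
      intro k hk
      rcases Finset.mem_insert.1 hk with rfl | hk
      · exact h01
      · exact (hI k hk).1) hM
  -- At the interpolation points the ramp at `p₀` is affine and the ramp at `p₁` vanishes, so
  -- neither extreme is needed as a knot.
  have hint : ∀ t ∈ insert p₀ (insert p₁ I),
      f t = ∑ k ∈ I, a k * max (t - k) 0 + (a p₀ * t + (f p₀ - a p₀ * p₀)) := by
    intro t ht
    have h := ha t ht
    rw [Finset.sum_insert hn0, Finset.sum_insert hn1, max_eq_left (by linarith [hge t ht]),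
      max_eq_right (by linarith [hle t ht] : t - p₁ ≤ 0)] at h
    linarith
  refine ⟨a, a p₀, f p₀ - a p₀ * p₀, hint, ?_⟩
  -- The dual certificate: a test spline equal to the sign of the slope change at every interior
  -- knot.
  obtain ⟨c, hc, hcb, hcs, hc0, hc1⟩ := exists_compactlySupported_interpolation h01 I hI
    (fun k => if k ∈ I then (SignType.sign (a k) : ℝ) else 0)
    (if_neg fun h => hn0 (Finset.mem_insert_of_mem h)) (if_neg hn1) (by
      intro k
      split_ifs
      · rcases SignType.sign (a k) with _ | _ | _ <;> simp
      · simp)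
  have hpair : ∑ k ∈ I, |a k| = ∑ p ∈ insert p₀ (insert p₁ I), c p * f p := by
    generalize hP : insert p₀ (insert p₁ I) = P at *
    -- `(p - k)₊` and `(k - p)₊` differ by `p - k`, which the vanishing moments `∑ c_p` and `∑ c_p
    -- p` annihilate.
    have hflip : ∀ k ∈ I, ∑ p ∈ P, c p * max (p - k) 0 = SignType.sign (a k) := by
      intro k hk
      have h := hc k hk
      rw [if_pos hk] at h
      rw [← h]
      have : ∀ p ∈ P, c p * max (p - k) 0 = c p * max (k - p) 0 + (c p * p - c p * k) := by
        intro p _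
        rcases le_total p k with h | h
        · rw [max_eq_right (by linarith), max_eq_left (by linarith)]; ring
        · rw [max_eq_left (by linarith), max_eq_right (by linarith)]; ring
      rw [Finset.sum_congr rfl this, Finset.sum_add_distrib, Finset.sum_sub_distrib,
        ← Finset.sum_mul, hc0, hc1]
      ring
    have h1 : ∀ p ∈ P, c p * f p = ∑ k ∈ I, a k * (c p * max (p - k) 0)
        + (a p₀ * (c p * p) + (f p₀ - a p₀ * p₀) * c p) := by
      intro p hp
      rw [hint p hp, mul_add, Finset.mul_sum]
      congr 1
      · exact Finset.sum_congr rfl fun k _ => by ring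
      · ring
    rw [Finset.sum_congr rfl h1, Finset.sum_add_distrib, Finset.sum_add_distrib, ← Finset.mul_sum,
      ← Finset.mul_sum, hc0, hc1, Finset.sum_comm]
    simp only [mul_zero, add_zero]
    refine Finset.sum_congr rfl fun k hk => ?_
    rw [← Finset.mul_sum, hflip k hk, self_mul_sign]
  rw [hpair]
  exact ofReal_sum_le_TV2 hf _ c hcs hcb

theorem exists_spline_interpolation {f : ℝ → ℝ} (hf : Continuous f) (P : Finset ℝ)
    (hP : 1 < P.card) :
    ∃ I ⊆ P, I.card + 2 ≤ P.card ∧ ∃ (a : ℝ → ℝ) (b₁ b₂ : ℝ),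
      (∀ t ∈ P, f t = ∑ k ∈ I, a k * max (t - k) 0 + (b₁ * t + b₂)) ∧
      ENNReal.ofReal (∑ k ∈ I, |a k|) ≤ TV2 f := by
  have hne : P.Nonempty := Finset.card_pos.1 (by omega)
  have h01 := Finset.min'_lt_max'_of_card P hP
  have h1 : P.max' hne ∈ P.erase (P.min' hne) :=
    Finset.mem_erase.2 ⟨h01.ne', P.max'_mem hne⟩
  have h0 := P.min'_mem hne
  set I := (P.erase (P.min' hne)).erase (P.max' hne) with hI
  have hIP : insert (P.min' hne) (insert (P.max' hne) I) = P := by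
    rw [hI, Finset.insert_erase h1, Finset.insert_erase h0]
  have hb : ∀ k ∈ I, P.min' hne < k ∧ k < P.max' hne := by
    intro k hk
    simp only [hI, Finset.mem_erase] at hk
    exact ⟨lt_of_le_of_ne (P.min'_le k hk.2.2) (Ne.symm hk.2.1),
      lt_of_le_of_ne (P.le_max' k hk.2.2) hk.1⟩
  refine ⟨I, (Finset.erase_subset _ _).trans (Finset.erase_subset _ _), ?_, ?_⟩
  · rw [hI, Finset.card_erase_of_mem h1, Finset.card_erase_of_mem h0]; omega
  · have := exists_spline_interpolation_of_lt hf h01 I hb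
    rwa [hIP] at this

/-! ### Splines parametrized by slope changes, knots and two values -/

/-- The spline with jumps of slope `a k` at `τ k` and with values `v₀`, `v₁` at `0`, `1`. -/
noncomputable def spline {M : ℕ} (a τ : Fin M → ℝ) (v₀ v₁ t : ℝ) : ℝ :=
  ∑ k, a k * (max (t - τ k) 0 - (1 - t) * max (0 - τ k) 0 - t * max (1 - τ k) 0)
    + ((1 - t) * v₀ + t * v₁)

theorem spline_eq {M : ℕ} (a τ : Fin M → ℝ) (v₀ v₁ t : ℝ) :
    spline a τ v₀ v₁ t = ∑ k, a k * max (t - τ k) 0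
      + ((v₁ - v₀ + ∑ k, a k * (max (0 - τ k) 0 - max (1 - τ k) 0)) * t
        + (v₀ - ∑ k, a k * max (0 - τ k) 0)) := by
  have : ∀ k, a k * (max (t - τ k) 0 - (1 - t) * max (0 - τ k) 0 - t * max (1 - τ k) 0)
      = a k * max (t - τ k) 0 + a k * (max (0 - τ k) 0 - max (1 - τ k) 0) * t
        - a k * max (0 - τ k) 0 := fun k => by ring
  simp only [spline, this, Finset.sum_sub_distrib, Finset.sum_add_distrib, ← Finset.sum_mul]
  ring

@[simp] theorem spline_zero {M : ℕ} (a τ : Fin M → ℝ) (v₀ v₁ : ℝ) : spline a τ v₀ v₁ 0 = v₀ := by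
  simp [spline]

@[simp] theorem spline_one {M : ℕ} (a τ : Fin M → ℝ) (v₀ v₁ : ℝ) : spline a τ v₀ v₁ 1 = v₁ := by
  simp [spline]

theorem isLinearSpline_spline {M : ℕ} (a τ : Fin M → ℝ) (v₀ v₁ : ℝ) :
    IsLinearSpline M (spline a τ v₀ v₁) :=
  ⟨M, le_rfl, a, τ, _, _, fun t => (spline_eq a τ v₀ v₁ t).trans (add_assoc _ _ _).symm⟩

theorem TV2_spline_fin_le {M : ℕ} (a τ : Fin M → ℝ) (v₀ v₁ : ℝ) :
    TV2 (spline a τ v₀ v₁) ≤ ENNReal.ofReal (∑ k, |a k|) := by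
  rw [show spline a τ v₀ v₁ = _ from funext (spline_eq a τ v₀ v₁)]
  exact TV2_spline_le Finset.univ a τ _ _

theorem isBV2_spline {M : ℕ} (a τ : Fin M → ℝ) (v₀ v₁ : ℝ) : IsBV2 (spline a τ v₀ v₁) :=
  ⟨by unfold spline; fun_prop, (TV2_spline_fin_le a τ v₀ v₁).trans_lt ENNReal.ofReal_lt_top⟩

/-- Only an inequality, since slope changes at coinciding knots may cancel. -/
theorem bv2Norm_spline_le {M : ℕ} (a τ : Fin M → ℝ) (v₀ v₁ : ℝ) :
    bv2Norm (spline a τ v₀ v₁) ≤ ∑ k, |a k| + |v₀| + |v₁| := by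
  have h := ENNReal.toReal_le_of_le_ofReal (Finset.sum_nonneg fun _ _ => abs_nonneg _)
    (TV2_spline_fin_le a τ v₀ v₁)
  rw [bv2Norm, spline_zero, spline_one]
  gcongr

/-- Each ramp enters minus its linear interpolant at 0 and 1. Since ramps are 1-Lipschitz, this
difference grows linearly in `t`, uniformly in the knot. -/
theorem abs_spline_le {M : ℕ} (a τ : Fin M → ℝ) (v₀ v₁ t : ℝ) :
    |spline a τ v₀ v₁ t| ≤ (∑ k, |a k| + |v₀| + |v₁|) * (1 + 2 * |t|) := by
  have hG : ∀ p : ℝ,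
      |max (t - p) 0 - (1 - t) * max (0 - p) 0 - t * max (1 - p) 0| ≤ 1 + 2 * |t| := by
    intro p
    have h1 : |max (t - p) 0 - max (0 - p) 0| ≤ |t| := by
      simpa using abs_max_sub_max_le_abs (t - p) (0 - p) 0
    have h2 : |max (0 - p) 0 - max (1 - p) 0| ≤ 1 := by
      refine (abs_max_sub_max_le_abs _ _ _).trans ?_
      rw [sub_sub_sub_cancel_right, zero_sub, abs_neg, abs_one]
    have h3 : max (t - p) 0 - (1 - t) * max (0 - p) 0 - t * max (1 - p) 0
        = (max (t - p) 0 - max (0 - p) 0) + t * (max (0 - p) 0 - max (1 - p) 0) := by ring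
    rw [h3]
    refine (abs_add_le _ _).trans ?_
    rw [abs_mul]
    nlinarith [abs_nonneg t]
  have h0 : |1 - t| ≤ 1 + 2 * |t| := by
    refine (abs_sub _ _).trans ?_
    rw [abs_one]; linarith [abs_nonneg t]
  have h1 : |t| ≤ 1 + 2 * |t| := by linarith [abs_nonneg t]
  calc |spline a τ v₀ v₁ t| ≤ ∑ k, |a k| * (1 + 2 * |t|)
        + ((1 + 2 * |t|) * |v₀| + (1 + 2 * |t|) * |v₁|) := by
        refine (abs_add_le _ _).trans (add_le_add ((Finset.abs_sum_le_sum_abs _ _).trans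
          (Finset.sum_le_sum fun k _ => ?_)) ((abs_add_le _ _).trans (add_le_add ?_ ?_)))
        · rw [abs_mul]; exact mul_le_mul_of_nonneg_left (hG _) (abs_nonneg _)
        · rw [abs_mul]; exact mul_le_mul_of_nonneg_right h0 (abs_nonneg _)
        · rw [abs_mul]; exact mul_le_mul_of_nonneg_right h1 (abs_nonneg _)
    _ = _ := by rw [← Finset.sum_mul]; ring

/-- A finite family of coefficients and knots can be indexed by `Fin M` if it is small enough. -/
theorem exists_fin_indexing {M : ℕ} (I : Finset ℝ) (hI : I.card ≤ M) (a : ℝ → ℝ) {B : ℝ}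
    (hB : ∀ k ∈ I, |k| ≤ B) (hB0 : 0 ≤ B) :
    ∃ a' τ : Fin M → ℝ, (∀ i, |τ i| ≤ B) ∧ ∀ G : ℝ → ℝ → ℝ, (∀ k, G 0 k = 0) →
      ∑ i, G (a' i) (τ i) = ∑ k ∈ I, G (a k) k := by
  obtain ⟨e⟩ : Nonempty (I ↪ Fin M) :=
    Function.Embedding.nonempty_of_card_le (by simpa using hI)
  -- Spare indices get slope change 0 and knot 0, which contribute nothing to the sums and respect
  -- the bound.
  refine ⟨Function.extend e (fun k => a k) 0, Function.extend e (fun k => (k : ℝ)) 0,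
    fun i => ?_, fun G hG => ?_⟩
  · by_cases h : ∃ k, e k = i
    · obtain ⟨k, rfl⟩ := h
      rw [e.injective.extend_apply]; exact hB k k.2
    · rw [Function.extend_apply' _ _ _ h]; simpa using hB0
  · rw [← Finset.sum_coe_sort I fun k => G (a k) k]
    symm
    refine Fintype.sum_of_injective e e.injective _ _ (fun i hi => ?_) fun k => ?_
    · rw [Function.extend_apply' _ _ _ fun h => hi h]; exact hG _
    · rw [e.injective.extend_apply, e.injective.extend_apply]

/-- At `M` points an element of `BV⁽²⁾` agrees with a spline with `M` knots that does not have a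
larger norm. -/
theorem IsBV2.exists_spline {f : ℝ → ℝ} (hf : IsBV2 f) {M : ℕ} (t : Fin M → ℝ) {B : ℝ}
    (hB1 : 1 ≤ B) (hB : ∀ m, |t m| ≤ B) :
    ∃ a τ : Fin M → ℝ, (∀ k, |τ k| ≤ B) ∧ (∀ m, spline a τ (f 0) (f 1) (t m) = f (t m)) ∧
      ∑ k, |a k| + |f 0| + |f 1| ≤ bv2Norm f := by
  classical
  -- Adding 0 and 1 preserves the point values in the norm; dropping the two extremes as knots
  -- brings `M + 2` back to `M`.
  set P : Finset ℝ := insert 0 (insert 1 (Finset.univ.image t)) with hP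
  have h0 : (0 : ℝ) ∈ P := by simp [hP]
  have h1 : (1 : ℝ) ∈ P := by simp [hP]
  have hcard : P.card ≤ M + 2 := by
    refine (Finset.card_insert_le _ _).trans (Nat.succ_le_succ
      ((Finset.card_insert_le _ _).trans (Nat.succ_le_succ ?_)))
    simpa using Finset.card_image_le (s := Finset.univ) (f := t)
  obtain ⟨I, hIP, hIc, a, b₁, b₂, hint, hTV⟩ := exists_spline_interpolation hf.continuous P
    (Finset.one_lt_card.2 ⟨0, h0, 1, h1, zero_ne_one⟩)
  obtain ⟨a', τ, hτ, hsum⟩ := exists_fin_indexing I (M := M) (by omega) a (B := B) (by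
    intro k hk
    have := hIP hk
    simp only [hP, Finset.mem_insert, Finset.mem_image, Finset.mem_univ, true_and] at this
    rcases this with rfl | rfl | ⟨m, rfl⟩
    · simp; linarith
    · simpa using hB1
    · exact hB m) (by linarith)
  refine ⟨a', τ, hτ, fun m => ?_, ?_⟩
  · have e0 := hint 0 h0
    have e1 := hint 1 h1
    have et := hint (t m) (by simp [hP])
    rw [spline_eq, hsum (fun x k => x * max (t m - k) 0) (by simp),
      hsum (fun x k => x * (max (0 - k) 0 - max (1 - k) 0)) (by simp),
      hsum (fun x k => x * max (0 - k) 0) (by simp), et, e0, e1]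
    simp only [mul_sub, Finset.sum_sub_distrib]
    ring
  · rw [hsum (fun x _ => |x|) (by simp), bv2Norm]
    gcongr
    exact (ENNReal.ofReal_le_iff_le_toReal hf.tv2_lt_top.ne).1 hTV

theorem bv2Norm_nonneg (f : ℝ → ℝ) : 0 ≤ bv2Norm f := by
  unfold bv2Norm; positivity

/-- Interpolation at the single point `t` transfers the growth bound from splines. -/
theorem IsBV2.abs_le {f : ℝ → ℝ} (hf : IsBV2 f) (t : ℝ) : |f t| ≤ bv2Norm f * (1 + 2 * |t|) := by
  obtain ⟨a, τ, -, h, hn⟩ := hf.exists_spline (M := 1) (fun _ => t) (B := max 1 |t|)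
    (le_max_left _ _) (fun _ => le_max_right _ _)
  rw [← h 0]
  exact (abs_spline_le _ _ _ _ _).trans (by gcongr)

/-! ### Coercivity and semicontinuity in the extended reals -/

theorem IsCoercive.exists_isCompact {X : Type*} [TopologicalSpace X] {F : X → EReal}
    (hF : IsCoercive F) (c : ℝ) : ∃ K : Set X, IsCompact K ∧ ∀ z, F z ≤ c → z ∈ K := by
  have h : ∀ᶠ z in cocompact X, (c : EReal) < F z :=
    hF.eventually (lt_mem_nhds (EReal.coe_lt_top c))
  obtain ⟨K, hK, hKs⟩ := mem_cocompact.1 h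
  exact ⟨K, hK, fun z hz => by_contra fun hzK => (hKs hzK).not_ge hz⟩

theorem IsCoercive.exists_real_le {X : Type*} [TopologicalSpace X] {F : X → EReal}
    (hF : IsCoercive F) (hl : LowerSemicontinuous F) (hb : ∀ z, F z ≠ ⊥) :
    ∃ c : ℝ, ∀ z, (c : EReal) ≤ F z := by
  obtain ⟨K, hK, hKs⟩ := hF.exists_isCompact 0
  rcases K.eq_empty_or_nonempty with rfl | hne
  · exact ⟨0, fun z => (not_le.1 fun h => hKs z h).le⟩
  · obtain ⟨z₀, -, hmin⟩ := (hl.lowerSemicontinuousOn K).exists_isMinOn hne hK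
    -- The minimum over `K` may be `⊤`, so a real number strictly below it is taken.
    obtain ⟨c, -, hc⟩ := EReal.lt_iff_exists_real_btwn.1 (bot_lt_iff_ne_bot.2 (hb z₀))
    refine ⟨min c 0, fun z => ?_⟩
    by_cases hz : z ∈ K
    · exact (EReal.coe_le_coe_iff.2 (min_le_left _ _)).trans (hc.le.trans (hmin hz))
    · exact (EReal.coe_le_coe_iff.2 (min_le_right _ _)).trans (not_le.1 fun h => hz (hKs z h)).le

theorem sum_ne_bot {ι : Type*} (s : Finset ι) {F : ι → EReal} (h : ∀ i ∈ s, F i ≠ ⊥) :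
    ∑ i ∈ s, F i ≠ ⊥ := by
  classical
  induction s using Finset.induction_on with
  | empty => simp
  | insert i s hi ih =>
    rw [Finset.sum_insert hi, ne_eq, EReal.add_eq_bot_iff, not_or]
    exact ⟨h i (Finset.mem_insert_self _ _), ih fun j hj => h j (Finset.mem_insert_of_mem hj)⟩

/-- Excluding `⊥` avoids the sums `⊥ + ⊤`, at which extended-real addition is discontinuous. -/
theorem lowerSemicontinuous_sum_of_ne_bot {X ι : Type*} [TopologicalSpace X] (s : Finset ι)
    {F : ι → X → EReal} (hl : ∀ i ∈ s, LowerSemicontinuous (F i)) (hb : ∀ i ∈ s, ∀ z, F i z ≠ ⊥) :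
    LowerSemicontinuous fun z => ∑ i ∈ s, F i z := by
  classical
  induction s using Finset.induction_on with
  | empty => simpa using lowerSemicontinuous_const
  | insert i s hi ih =>
    simp only [Finset.sum_insert hi]
    have hb' : ∀ j ∈ s, ∀ z, F j z ≠ ⊥ := fun j hj => hb j (Finset.mem_insert_of_mem hj)
    exact (hl i (Finset.mem_insert_self _ _)).add'
      (ih (fun j hj => hl j (Finset.mem_insert_of_mem hj)) hb') fun z =>
        EReal.continuousAt_add (.inr (sum_ne_bot s fun j hj => hb' j hj z))
          (.inl (hb i (Finset.mem_insert_self _ _) z))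

/-! ### The finite-dimensional problem -/

/-- The parameters of a neuron: slope changes, knots, and the values of the activation at `0`
and `1`. -/
abbrev NeuronParam (M : ℕ) : Type := (Fin M → ℝ) × (Fin M → ℝ) × ℝ × ℝ

/-- An upper bound of the norm of the activation of a neuron. -/
noncomputable def neuronNorm {M : ℕ} (p : NeuronParam M) : ℝ := ∑ k, |p.1 k| + |p.2.2.1| + |p.2.2.2|

/-- The parameters of a network with spline activations with `M` knots. -/
abbrev NetworkParam {L : ℕ} (N : Fin (L + 1) → ℕ) (M : ℕ) : Type :=
  (∀ l : Fin L, Matrix (Fin (N l.succ)) (Fin (N l.castSucc)) ℝ) ×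
    (∀ l : Fin L, Fin (N l.succ) → NeuronParam M)

variable {L : ℕ} {N : Fin (L + 1) → ℕ} {M : ℕ}

/-- The network with spline activations that is described by `θ`. -/
noncomputable def splineNetwork (θ : NetworkParam N M) : Network N where
  weight := θ.1
  activation l n := spline (θ.2 l n).1 (θ.2 l n).2.1 (θ.2 l n).2.2.1 (θ.2 l n).2.2.2
  activation_mem _ _ := isBV2_spline _ _ _ _

theorem Network.partialEval_succ (f : Network N) (x : Fin (N 0) → ℝ) (l : Fin L) :
    f.partialEval x l.succ = f.layer l (f.partialEval x l.castSucc) := rfl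

theorem continuous_spline_comp {X : Type*} [TopologicalSpace X] {p : X → NeuronParam M} {t : X → ℝ}
    (hp : Continuous p) (ht : Continuous t) :
    Continuous fun z => spline (p z).1 (p z).2.1 (p z).2.2.1 (p z).2.2.2 (t z) := by
  unfold spline
  fun_prop

theorem continuous_neuronNorm : Continuous (neuronNorm (M := M)) := by
  unfold neuronNorm
  fun_prop

theorem continuous_partialEval_splineNetwork (x : Fin (N 0) → ℝ) (i : Fin (L + 1)) :
    Continuous fun θ : NetworkParam N M => (splineNetwork θ).partialEval x i := by
  induction i using Fin.induction with
  | zero => exact continuous_const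
  | succ l ih =>
    simp only [Network.partialEval_succ]
    refine continuous_pi fun n => continuous_spline_comp (p := fun θ : NetworkParam N M => θ.2 l n)
      (by fun_prop) ?_
    have hW : Continuous fun θ : NetworkParam N M => θ.1 l := by fun_prop
    exact (continuous_apply n).comp (hW.matrix_mulVec ih)

/-- The training cost in terms of the parameters; it dominates the cost of the network. -/
noncomputable def splineCost (x : Fin M → Fin (N 0) → ℝ) (y : Fin M → Fin (N (Fin.last L)) → ℝ)
    (E : (Fin (N (Fin.last L)) → ℝ) → (Fin (N (Fin.last L)) → ℝ) → EReal)
    (R : ∀ l : Fin L, Matrix (Fin (N l.succ)) (Fin (N l.castSucc)) ℝ → ℝ)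
    (μ lam : Fin L → ℝ) (θ : NetworkParam N M) : EReal :=
  (∑ m, E (y m) ((splineNetwork θ).eval (x m)))
    + ((∑ l, μ l * R l (θ.1 l) + ∑ l, lam l * ∑ n, neuronNorm (θ.2 l n) : ℝ) : EReal)

section

variable {x : Fin M → Fin (N 0) → ℝ} {y : Fin M → Fin (N (Fin.last L)) → ℝ}
  {E : (Fin (N (Fin.last L)) → ℝ) → (Fin (N (Fin.last L)) → ℝ) → EReal}
  {R : ∀ l : Fin L, Matrix (Fin (N l.succ)) (Fin (N l.castSucc)) ℝ → ℝ} {μ lam : Fin L → ℝ}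

theorem cost_splineNetwork_le (hlam : ∀ l, 0 < lam l) (θ : NetworkParam N M) :
    cost x y E R μ lam (splineNetwork θ) ≤ splineCost x y E R μ lam θ := by
  refine add_le_add le_rfl (EReal.coe_le_coe_iff.2 (add_le_add le_rfl
    (Finset.sum_le_sum fun l _ => mul_le_mul_of_nonneg_left ?_ (hlam l).le)))
  exact Finset.sum_le_sum fun n _ => bv2Norm_spline_le _ _ _ _

theorem lowerSemicontinuous_splineCost (hE : ∀ v z, E v z ≠ ⊥)
    (hE_lsc : ∀ v, LowerSemicontinuous (E v)) (hR : ∀ l, Continuous (R l)) :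
    LowerSemicontinuous (splineCost (M := M) x y E R μ lam) := by
  have h1 : LowerSemicontinuous fun θ : NetworkParam N M =>
      ∑ m, E (y m) ((splineNetwork θ).eval (x m)) :=
    lowerSemicontinuous_sum_of_ne_bot _ (fun m _ => (hE_lsc (y m)).comp
      (continuous_partialEval_splineNetwork (x m) (Fin.last L))) fun _ _ _ => hE _ _
  have h2 : Continuous fun θ : NetworkParam N M =>
      (∑ l, μ l * R l (θ.1 l) + ∑ l, lam l * ∑ n, neuronNorm (θ.2 l n) : ℝ) := by
    have := continuous_neuronNorm (M := M)
    fun_prop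
  exact h1.add' (continuous_coe_real_ereal.comp h2).lowerSemicontinuous fun θ =>
    EReal.continuousAt_add (.inr (EReal.coe_ne_bot _)) (.inr (EReal.coe_ne_top _))

/-! ### A priori bounds -/

/-- A bound on the cost confines the weights to compact sets and bounds the activations. -/
theorem exists_bounds_of_cost_le (hE : ∀ v z, E v z ≠ ⊥)
    (hE_lsc : ∀ v, LowerSemicontinuous (E v)) (hE_coercive : ∀ v, IsCoercive (E v))
    (hR_cont : ∀ l, Continuous (R l)) (hR_coercive : ∀ l, IsCoercive fun W => (R l W : EReal))
    (hμ : ∀ l, 0 < μ l) (hlam : ∀ l, 0 < lam l) (c : ℝ) :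
    ∃ (K : ∀ l : Fin L, Set (Matrix (Fin (N l.succ)) (Fin (N l.castSucc)) ℝ)) (C : Fin L → ℝ),
      (∀ l, IsCompact (K l)) ∧ ∀ g : Network N, cost x y E R μ lam g ≤ c →
        (∀ l, g.weight l ∈ K l) ∧ ∀ l n, bv2Norm (g.activation l n) ≤ C l := by
  choose e he using fun v => (hE_coercive v).exists_real_le (hE_lsc v) (hE v)
  choose r hr using fun l => (hR_coercive l).exists_real_le
    (continuous_coe_real_ereal.comp (hR_cont l)).lowerSemicontinuous fun _ => EReal.coe_ne_bot _
  -- The budget left after subtracting lower bounds of the data and weight terms; each remaining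
  -- summand is nonnegative, so each is at most `c'`.
  set c' := c - ∑ m, e (y m) - ∑ l, μ l * r l with hc'
  choose K hK hKs using fun l => (hR_coercive l).exists_isCompact (c' / μ l + r l)
  refine ⟨K, fun l => c' / lam l, hK, fun g hg => ?_⟩
  have hsum : ((∑ m, e (y m) : ℝ) : EReal) ≤ ∑ m, E (y m) (g.eval (x m)) := by
    have : ((∑ m, e (y m) : ℝ) : EReal) = ∑ m, (e (y m) : EReal) :=
      map_sum (⟨⟨Real.toEReal, EReal.coe_zero⟩, EReal.coe_add⟩ : ℝ →+ EReal) _ _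
    rw [this]
    exact Finset.sum_le_sum fun m _ => he _ _
  have hreg : ∑ m, e (y m) + (∑ l, μ l * R l (g.weight l) + ∑ l, lam l * g.layerNorm l) ≤ c := by
    rw [← EReal.coe_le_coe_iff, EReal.coe_add]
    exact (add_le_add hsum le_rfl).trans hg
  have hRr : ∀ l, 0 ≤ μ l * (R l (g.weight l) - r l) := fun l =>
    mul_nonneg (hμ l).le (sub_nonneg.2 (EReal.coe_le_coe_iff.1 (hr l _)))
  have hnn : ∀ l, 0 ≤ lam l * g.layerNorm l := fun l =>
    mul_nonneg (hlam l).le (Finset.sum_nonneg fun n _ => bv2Norm_nonneg _)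
  have htot : ∑ l, μ l * (R l (g.weight l) - r l) + ∑ l, lam l * g.layerNorm l ≤ c' := by
    simp only [mul_sub, Finset.sum_sub_distrib]
    linarith
  refine ⟨fun l => hKs l _ (EReal.coe_le_coe_iff.2 ?_), fun l n => ?_⟩
  · have h1 := Finset.single_le_sum (fun l _ => hRr l) (Finset.mem_univ l)
    have h2 := Finset.sum_nonneg fun l (_ : l ∈ Finset.univ) => hnn l
    rw [← sub_le_iff_le_add, le_div_iff₀' (hμ l)]
    linarith
  · have h1 := Finset.single_le_sum (fun l _ => hnn l) (Finset.mem_univ l)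
    have h2 := Finset.sum_nonneg fun l (_ : l ∈ Finset.univ) => hRr l
    have h3 : bv2Norm (g.activation l n) ≤ g.layerNorm l :=
      Finset.single_le_sum (f := fun n => bv2Norm (g.activation l n))
        (fun n _ => bv2Norm_nonneg _) (Finset.mem_univ n)
    refine h3.trans ?_
    rw [le_div_iff₀' (hlam l)]
    linarith

end

theorem exists_bound_mulVec {m n : ℕ} {K : Set (Matrix (Fin m) (Fin n) ℝ)} (hK : IsCompact K)
    (B : ℝ) : ∃ B', ∀ W ∈ K, ∀ z : Fin n → ℝ, (∀ j, |z j| ≤ B) → ∀ i, |W.mulVec z i| ≤ B' := by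
  have hZ : IsCompact (Set.univ.pi fun _ : Fin n => Set.Icc (-B) B) :=
    isCompact_univ_pi fun _ => isCompact_Icc
  obtain ⟨B', hB'⟩ := (hK.prod hZ).exists_bound_of_continuousOn
    (f := fun p : Matrix (Fin m) (Fin n) ℝ × (Fin n → ℝ) => p.1.mulVec p.2)
    (continuous_fst.matrix_mulVec continuous_snd).continuousOn
  exact ⟨B', fun W hW z hz i => (norm_le_pi_norm _ i).trans
    (hB' (W, z) ⟨hW, fun j _ => abs_le.1 (hz j)⟩)⟩

/-- The inputs of the neurons are bounded uniformly over a bounded family of networks. -/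
theorem exists_bound_preactivation (x : Fin M → Fin (N 0) → ℝ)
    {K : ∀ l : Fin L, Set (Matrix (Fin (N l.succ)) (Fin (N l.castSucc)) ℝ)}
    (hK : ∀ l, IsCompact (K l)) (C : Fin L → ℝ) (l : Fin L) :
    ∃ B : ℝ, 1 ≤ B ∧ ∀ g : Network N, (∀ l, g.weight l ∈ K l) →
      (∀ l n, bv2Norm (g.activation l n) ≤ C l) →
      ∀ m n, |(g.weight l).mulVec (g.partialEval (x m) l.castSucc) n| ≤ B := by
  have main : ∀ i : Fin (L + 1), ∃ B : ℝ, ∀ g : Network N, (∀ l, g.weight l ∈ K l) →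
      (∀ l n, bv2Norm (g.activation l n) ≤ C l) → ∀ m n, |g.partialEval (x m) i n| ≤ B := by
    intro i
    induction i using Fin.induction with
    | zero =>
      obtain ⟨B, hB⟩ := (Finset.univ.image fun m => ‖x m‖).bddAbove
      refine ⟨B, fun g _ _ m n => (norm_le_pi_norm (x m) n).trans (hB ?_)⟩
      exact Finset.mem_coe.2 (Finset.mem_image_of_mem (fun m => ‖x m‖) (Finset.mem_univ m))
    | succ l ih =>
      obtain ⟨B, hB⟩ := ih
      obtain ⟨B', hB'⟩ := exists_bound_mulVec (hK l) B
      refine ⟨C l * (1 + 2 * B'), fun g hg hC m n => ?_⟩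
      rw [Network.partialEval_succ]
      refine ((g.activation_mem l n).abs_le _).trans ?_
      have h := hB' _ (hg l) _ (hB g hg hC m) n
      have h0 := bv2Norm_nonneg (g.activation l n)
      have := hC l n
      gcongr
      exact h0.trans this
  obtain ⟨B, hB⟩ := main l.castSucc
  obtain ⟨B', hB'⟩ := exists_bound_mulVec (hK l) B
  -- The bound is at least 1 because 0 and 1 may also occur as knots.
  exact ⟨max 1 B', le_max_left _ _, fun g hg hC m n =>
    (hB' _ (hg l) _ (hB g hg hC m) n).trans (le_max_right _ _)⟩

/-! ### Reduction to spline networks and existence -/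

theorem Network.partialEval_eq_of_activation_eq {f g : Network N} {x : Fin (N 0) → ℝ}
    (hW : f.weight = g.weight)
    (h : ∀ l n, f.activation l n ((g.weight l).mulVec (g.partialEval x l.castSucc) n)
      = g.activation l n ((g.weight l).mulVec (g.partialEval x l.castSucc) n))
    (i : Fin (L + 1)) : f.partialEval x i = g.partialEval x i := by
  induction i using Fin.induction with
  | zero => rfl
  | succ l ih =>
    rw [partialEval_succ, partialEval_succ, ih]
    ext n
    simp only [layer, hW]
    exact h l n

/-- The parameters with weights in `K`, knots bounded by `B`, and neurons bounded by `C`. -/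
def paramSet (M : ℕ) (K : ∀ l : Fin L, Set (Matrix (Fin (N l.succ)) (Fin (N l.castSucc)) ℝ))
    (B C : Fin L → ℝ) : Set (NetworkParam N M) :=
  (Set.univ.pi K) ×ˢ (Set.univ.pi fun l => Set.univ.pi fun _ =>
    (Set.univ.pi fun _ => Set.Icc (-C l) (C l)) ×ˢ (Set.univ.pi fun _ => Set.Icc (-B l) (B l)) ×ˢ
      Set.Icc (-C l) (C l) ×ˢ Set.Icc (-C l) (C l))

theorem isCompact_paramSet
    {K : ∀ l : Fin L, Set (Matrix (Fin (N l.succ)) (Fin (N l.castSucc)) ℝ)}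
    (hK : ∀ l, IsCompact (K l)) (B C : Fin L → ℝ) : IsCompact (paramSet M K B C) :=
  (isCompact_univ_pi hK).prod (isCompact_univ_pi fun _ => isCompact_univ_pi fun _ =>
    (isCompact_univ_pi fun _ => isCompact_Icc).prod <|
      (isCompact_univ_pi fun _ => isCompact_Icc).prod (isCompact_Icc.prod isCompact_Icc))

/-- Replacing the activations of a network by splines that agree on the data does not increase the
cost. -/
theorem exists_param_splineCost_le {x : Fin M → Fin (N 0) → ℝ}
    (y : Fin M → Fin (N (Fin.last L)) → ℝ)
    (E : (Fin (N (Fin.last L)) → ℝ) → (Fin (N (Fin.last L)) → ℝ) → EReal)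
    (R : ∀ l : Fin L, Matrix (Fin (N l.succ)) (Fin (N l.castSucc)) ℝ → ℝ) (μ : Fin L → ℝ)
    {lam : Fin L → ℝ} (hlam : ∀ l, 0 < lam l)
    {K : ∀ l : Fin L, Set (Matrix (Fin (N l.succ)) (Fin (N l.castSucc)) ℝ)} {B C : Fin L → ℝ}
    (hB1 : ∀ l, 1 ≤ B l) (g : Network N) (hg : ∀ l, g.weight l ∈ K l)
    (hC : ∀ l n, bv2Norm (g.activation l n) ≤ C l)
    (hB : ∀ l m n, |(g.weight l).mulVec (g.partialEval (x m) l.castSucc) n| ≤ B l) :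
    ∃ θ ∈ paramSet M K B C, splineCost x y E R μ lam θ ≤ cost x y E R μ lam g := by
  choose a τ hτ hval hnorm using fun l n => (g.activation_mem l n).exists_spline
    (fun m => (g.weight l).mulVec (g.partialEval (x m) l.castSucc) n) (hB1 l) (fun m => hB l m n)
  let θ : NetworkParam N M :=
    (g.weight, fun l n => (a l n, τ l n, g.activation l n 0, g.activation l n 1))
  have hθ : ∀ l n, neuronNorm (θ.2 l n) ≤ bv2Norm (g.activation l n) := hnorm
  have hak : ∀ l n k, |a l n k| ≤ ∑ k, |a l n k| := fun l n k =>
    Finset.single_le_sum (f := fun k => |a l n k|) (fun _ _ => abs_nonneg _) (Finset.mem_univ k)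
  refine ⟨θ, ⟨fun l _ => hg l, fun l _ n _ => ⟨fun k _ => ?_, fun k _ => ?_, ?_, ?_⟩⟩, ?_⟩
  · refine abs_le.1 ?_
    linarith [hnorm l n, hak l n k, hC l n, abs_nonneg (g.activation l n 0),
      abs_nonneg (g.activation l n 1)]
  · exact abs_le.1 (hτ l n k)
  · refine abs_le.1 ?_
    linarith [hnorm l n, hC l n, abs_nonneg (g.activation l n 1),
      Finset.sum_nonneg fun k (_ : k ∈ Finset.univ) => abs_nonneg (a l n k)]
  · refine abs_le.1 ?_
    linarith [hnorm l n, hC l n, abs_nonneg (g.activation l n 0),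
      Finset.sum_nonneg fun k (_ : k ∈ Finset.univ) => abs_nonneg (a l n k)]
  · have heval : ∀ m, (splineNetwork θ).eval (x m) = g.eval (x m) := fun m =>
      Network.partialEval_eq_of_activation_eq (f := splineNetwork θ) (g := g) rfl
        (fun l n => hval l n m) (Fin.last L)
    simp only [splineCost, cost, heval]
    exact add_le_add le_rfl (EReal.coe_le_coe_iff.2 (add_le_add le_rfl
      (Finset.sum_le_sum fun l _ => mul_le_mul_of_nonneg_left
        (Finset.sum_le_sum fun n _ => hθ l n) (hlam l).le)))

end DeepSpline

theorem mainTheorem1 {L : ℕ} (N : Fin (L + 1) → ℕ) {M : ℕ}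
    (x : Fin M → Fin (N 0) → ℝ) (y : Fin M → Fin (N (Fin.last L)) → ℝ)
    (E : (Fin (N (Fin.last L)) → ℝ) → (Fin (N (Fin.last L)) → ℝ) → EReal)
    (hE_proper : DeepSpline.IsProper (Function.uncurry E))
    (hE_lsc : ∀ v, LowerSemicontinuous (E v))
    (hE_coercive : ∀ v, DeepSpline.IsCoercive (E v))
    (R : ∀ l : Fin L, Matrix (Fin (N l.succ)) (Fin (N l.castSucc)) ℝ → ℝ)
    (hR_cont : ∀ l, Continuous (R l))
    (hR_coercive : ∀ l, DeepSpline.IsCoercive (fun W => (R l W : EReal)))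
    (μ lam : Fin L → ℝ) (hμ : ∀ l, 0 < μ l) (hlam : ∀ l, 0 < lam l) :
    ∃ f : DeepSpline.Network N,
      (∀ g : DeepSpline.Network N,
        DeepSpline.cost x y E R μ lam f ≤ DeepSpline.cost x y E R μ lam g) ∧
      ∀ l n, DeepSpline.IsLinearSpline M (f.activation l n) := by
  have hE : ∀ v z, E v z ≠ ⊥ := fun v z => hE_proper.1 (v, z)
  have hspline : ∀ (θ : DeepSpline.NetworkParam N M) l n,
      DeepSpline.IsLinearSpline M ((DeepSpline.splineNetwork θ).activation l n) :=
    fun θ l n => DeepSpline.isLinearSpline_spline _ _ _ _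
  by_cases hfin : ∃ g : DeepSpline.Network N, DeepSpline.cost x y E R μ lam g ≠ ⊤
  · obtain ⟨g₀, hg₀⟩ := hfin
    have hc := EReal.le_coe_toReal hg₀
    set c := (DeepSpline.cost x y E R μ lam g₀).toReal
    obtain ⟨K, C, hK, hKC⟩ := DeepSpline.exists_bounds_of_cost_le (x := x) (y := y) hE hE_lsc
      hE_coercive hR_cont hR_coercive hμ hlam c
    choose B hB1 hB using DeepSpline.exists_bound_preactivation x hK C
    have hparam : ∀ g : DeepSpline.Network N, DeepSpline.cost x y E R μ lam g ≤ c →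
        ∃ θ ∈ DeepSpline.paramSet M K B C,
          DeepSpline.splineCost x y E R μ lam θ ≤ DeepSpline.cost x y E R μ lam g := fun g hg =>
      DeepSpline.exists_param_splineCost_le y E R μ hlam hB1 g (hKC g hg).1 (hKC g hg).2
        fun l => hB l g (hKC g hg).1 (hKC g hg).2
    obtain ⟨θ₀, hθ₀, hθ₀c⟩ := hparam g₀ hc
    obtain ⟨θ, -, hθ⟩ := ((DeepSpline.lowerSemicontinuous_splineCost (x := x) (y := y) (μ := μ)
      (lam := lam) hE hE_lsc hR_cont).lowerSemicontinuousOn _).exists_isMinOn ⟨θ₀, hθ₀⟩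
      (DeepSpline.isCompact_paramSet hK B C)
    have hle := DeepSpline.cost_splineNetwork_le (x := x) (y := y) (E := E) (R := R) (μ := μ) hlam θ
    refine ⟨DeepSpline.splineNetwork θ, fun g => ?_, hspline θ⟩
    rcases le_or_gt (DeepSpline.cost x y E R μ lam g) c with hg | hg
    · obtain ⟨θ', hθ', hθ'c⟩ := hparam g hg
      exact hle.trans ((hθ hθ').trans hθ'c)
    -- Networks above the level `c` lose already to the spline replacement of `g₀`.
    · exact hle.trans ((hθ hθ₀).trans (hθ₀c.trans (hc.trans hg.le)))
  -- If every cost is infinite, any spline network is a minimizer.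
  · push Not at hfin
    exact ⟨DeepSpline.splineNetwork 0, fun g => (hfin g).symm ▸ le_top, hspline 0⟩
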